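/- Let $G$ be a finite, non-empty simple graph without isolated vertices, with vertex set $V_G$, edge set $E_G$ and $b_0(G)$ connected components, and let $K$ be any field. Let $\theta\colon K[t_e : e\in E_G]\to K[x_i : i\in V_G]$ be the homomorphism of $K$-algebras with $\theta(t_e)=x_ix_j$ for every edge $e=\{i,j\}$, and let $$I(X_G)=\theta^{-1}\bigl((x_i^2-x_j^2 : i,j\in V_G)\bigr)\subseteq K[E_G]=K[t_e : e\in E_G].$$ Then $I(X_G)$ is a homogeneous ideal, and its degree (that is, the multiplicity of the graded ring $K[E_G]/I(X_G)$: $(\deg P)!$ times the leading coefficient of its Hilbert polynomial $P$ if $P\neq 0$, and $\dim_K K[E_G]/I(X_G)$ if $P=0$) equals $2^{|V_G|-b_0(G)}$ if $G$ is non-bipartite, and $2^{|V_G|-b_0(G)-1}$ if $G$ is bipartite. -/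

import Mathlib

open MvPolynomial

namespace GraphIdeal

noncomputable section

/-- The Hilbert function of `K[σ] / I`: the `K`-dimension of the image of the forms of degree `n`
in the quotient (for homogeneous `I`, this is the degree `n` component of the quotient). -/
def hilbertFunction {σ K : Type*} [Field K] (I : Ideal (MvPolynomial σ K)) (n : ℕ) : ℕ :=
  Module.finrank K
    ((homogeneousSubmodule σ K n).map (Ideal.Quotient.mkₐ K I).toLinearMap)

/-- `P` is the Hilbert polynomial of `K[σ] / I`: it agrees with the Hilbert function in all
large degrees. Such a `P` is unique if it exists. -/
def IsHilbertPolynomial {σ K : Type*} [Field K] (I : Ideal (MvPolynomial σ K))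
    (P : Polynomial ℚ) : Prop :=
  ∃ N : ℕ, ∀ n : ℕ, N ≤ n → (hilbertFunction I n : ℚ) = P.eval (n : ℚ)

/-- The homogeneous ideal `I` has degree (multiplicity) `e`: `K[σ] / I` has a Hilbert polynomial
`P`, and `e` is `(deg P)!` times the leading coefficient of `P` if `P ≠ 0`, and the length
`dim_K (K[σ] / I)` if `P = 0`. -/
def HasDegree {σ K : Type*} [Field K] (I : Ideal (MvPolynomial σ K)) (e : ℕ) : Prop :=
  (∀ f ∈ I, ∀ n : ℕ, homogeneousComponent n f ∈ I) ∧
    ∃ P : Polynomial ℚ, IsHilbertPolynomial I P ∧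
      (P ≠ 0 → (e : ℚ) = (P.natDegree.factorial : ℚ) * P.leadingCoeff) ∧
      (P = 0 → e = Module.finrank K (MvPolynomial σ K ⧸ I))

variable {V : Type*} (K : Type*) [Field K] (G : SimpleGraph V)

/-- The homomorphism `θ : K[E_G] → K[V_G]` with `t_e ↦ x_i x_j` for `e = {i, j}`. -/
def theta : MvPolynomial G.edgeSet K →ₐ[K] MvPolynomial V K :=
  aeval fun e => (Sym2.map (fun i => (X i : MvPolynomial V K)) (e : Sym2 V)).mul

/-- The ideal `(x_i² - x_j² : i, j ∈ V)` of `K[V]`. -/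
def squaresIdeal (V K : Type*) [Field K] : Ideal (MvPolynomial V K) :=
  Ideal.span {f | ∃ i j : V, f = X i ^ 2 - X j ^ 2}

/-- The ideal `I(X_G) = θ⁻¹(x_i² - x_j² : i, j ∈ V_G)` of `K[E_G]`. -/
def idealXG : Ideal (MvPolynomial G.edgeSet K) :=
  (squaresIdeal V K).comap (theta K G)

end

end GraphIdeal

/-! Modulo the squares ideal a monomial is determined by its total degree and its exponents mod 2,
and distinct such data give independent classes (`squaresIdeal_eq_ker`). Hence `idealXG` is the
kernel of a monomial map, and its Hilbert function at `n` counts the sums of exactly `n` edge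
vectors in `F₂^V`.

All these sums lie in the span `W` of the edge vectors, the kernel of the component sums, of order
`2 ^ (|V| - b₀)`. Since `2g = 0`, a sum of `n` vectors is also a sum of `n + 2`. If an odd number of
edge vectors sums to zero, every large `n` reaches all of `W`. Otherwise a functional equal to 1 on
every edge vector, i.e. a 2-colouring, splits `W` by the parity of `n` into two equal halves. The
Hilbert polynomial is thus a constant, which is the degree. -/

namespace GraphIdeal

noncomputable section

/-! ### Kernels of monomial maps and their Hilbert functions -/

section MonomialMap

/-- The linear map out of `K[M]` with prescribed values on the monomials. -/
def linearExtend {M N K : Type*} [Field K] [AddCommGroup N] [Module K N] (h : M → N) :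
    AddMonoidAlgebra K M →ₗ[K] N :=
  (Finsupp.linearCombination K h) ∘ₗ (AddMonoidAlgebra.coeffLinearEquiv K).toLinearMap

lemma linearExtend_single {M N K : Type*} [Field K] [AddCommGroup N] [Module K N]
    (h : M → N) (p : M) (c : K) :
    linearExtend h (AddMonoidAlgebra.single p c) = c • h p := by
  simp [linearExtend]

variable {σ M K : Type*} [AddCommMonoid M] [Field K]

/-- The `K`-algebra map `K[σ] → K[M]` sending each variable `i` to the monomial with exponent
`g i`. -/
def monomialMap (K : Type*) [Field K] (g : σ → M) : MvPolynomial σ K →ₐ[K] AddMonoidAlgebra K M :=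
  aeval fun i => AddMonoidAlgebra.single (g i) 1

lemma monomialMap_monomial (g : σ → M) (a : σ →₀ ℕ) (c : K) :
    monomialMap K g (monomial a c) = AddMonoidAlgebra.single (a.sum fun i n => n • g i) c := by
  rw [monomialMap, aeval_monomial]
  simp only [AddMonoidAlgebra.single_pow, one_pow, Finsupp.prod]
  rw [AddMonoidAlgebra.prod_single]
  simp [AddMonoidAlgebra.single_mul_single, Finsupp.sum]

/-- The exponents of the images of the monomials of degree `n`. -/
def exponentSet (g : σ → M) (n : ℕ) : Set M :=
  (fun a : σ →₀ ℕ => a.sum fun i k => k • g i) '' {a | a.degree = n}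

lemma homogeneousSubmodule_map_monomialMap (g : σ → M) (n : ℕ) :
    (homogeneousSubmodule σ K n).map (monomialMap K g).toLinearMap =
      Submodule.span K ((fun p => AddMonoidAlgebra.single p (1 : K)) '' exponentSet g n) := by
  apply le_antisymm
  · rw [Submodule.map_le_iff_le_comap]
    intro f hf
    rw [Submodule.mem_comap, f.as_sum, map_sum]
    refine Submodule.sum_mem _ fun a ha => ?_
    have hdeg : a.degree = n := by
      have := hf (mem_support_iff.mp ha)
      rwa [Finsupp.degree_eq_weight_one]
    have : (monomialMap K g).toLinearMap (monomial a (coeff a f)) =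
        coeff a f • AddMonoidAlgebra.single (a.sum fun i k => k • g i) (1 : K) := by
      simp [monomialMap_monomial]
    rw [this]
    exact Submodule.smul_mem _ _ (Submodule.subset_span ⟨_, ⟨a, hdeg, rfl⟩, rfl⟩)
  · rw [Submodule.span_le]
    rintro _ ⟨_, ⟨a, ha, rfl⟩, rfl⟩
    exact ⟨monomial a 1, isHomogeneous_monomial _ ha, monomialMap_monomial g a 1⟩

lemma finrank_map_mk_ker {A B : Type*} [CommRing A] [CommRing B] [Algebra K A] [Algebra K B]
    (φ : A →ₐ[K] B) (W : Submodule K A) :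
    Module.finrank K (W.map (Ideal.Quotient.mkₐ K (RingHom.ker φ)).toLinearMap) =
      Module.finrank K (W.map φ.toLinearMap) := by
  have hκ : Function.Injective (Ideal.kerLiftAlg φ).toLinearMap := Ideal.kerLiftAlg_injective φ
  have hcomp : φ.toLinearMap = (Ideal.kerLiftAlg φ).toLinearMap ∘ₗ
      (Ideal.Quotient.mkₐ K (RingHom.ker φ)).toLinearMap := rfl
  rw [hcomp, Submodule.map_comp]
  exact (Submodule.equivMapOfInjective _ hκ _).finrank_eq

lemma finite_exponentSet [Finite σ] (g : σ → M) (n : ℕ) : (exponentSet g n).Finite :=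
  (Finsupp.finite_of_degree_eq n).image _

lemma hilbertFunction_ker_monomialMap [Finite σ] (g : σ → M) (n : ℕ) :
    hilbertFunction (RingHom.ker (monomialMap K g)) n = (exponentSet g n).ncard := by
  have := (finite_exponentSet g n).fintype
  have hli : LinearIndependent K fun p : exponentSet g n =>
      AddMonoidAlgebra.single (p : M) (1 : K) :=
    (AddMonoidAlgebra.basis M K).linearIndependent.comp _ Subtype.val_injective
  rw [hilbertFunction, finrank_map_mk_ker, homogeneousSubmodule_map_monomialMap,
    Set.image_eq_range, finrank_span_eq_card hli, Set.ncard_eq_toFinset_card', Set.toFinset_card]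

lemma homogeneousComponent_mem_ker_monomialMap (g : σ → M) (deg : M →+ ℕ) {d : ℕ} (hd : d ≠ 0)
    (hg : ∀ i, deg (g i) = d) {f : MvPolynomial σ K} (hf : f ∈ RingHom.ker (monomialMap K g))
    (n : ℕ) : homogeneousComponent n f ∈ RingHom.ker (monomialMap K g) := by
  classical
  have hdeg : ∀ a : σ →₀ ℕ, deg (a.sum fun i k => k • g i) = a.degree * d := by
    intro a
    simp [Finsupp.sum, map_sum, hg, Finsupp.degree_apply, Finset.sum_mul]
  -- The projection onto degree `n * d` in the target matches the one onto degree `n` in the source;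
  -- `d ≠ 0` makes `n * d` determine `n`.
  let π : AddMonoidAlgebra K M →ₗ[K] AddMonoidAlgebra K M :=
    linearExtend fun p => if deg p = n * d then AddMonoidAlgebra.single p 1 else 0
  have key : π ∘ₗ (monomialMap K g).toLinearMap =
      (monomialMap K g).toLinearMap ∘ₗ homogeneousComponent n := by
    refine MvPolynomial.linearMap_ext fun a => LinearMap.ext fun c => ?_
    simp only [LinearMap.comp_apply, AlgHom.toLinearMap_apply, monomialMap_monomial, π,
      linearExtend_single, hdeg]
    rw [homogeneousComponent_of_mem (isHomogeneous_monomial c rfl)]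
    by_cases h : a.degree = n
    · simp [h, monomialMap_monomial]
    · simp [h, hd, Ne.symm h]
  have := LinearMap.congr_fun key f
  simp only [LinearMap.comp_apply, AlgHom.toLinearMap_apply] at this
  rw [RingHom.mem_ker] at hf ⊢
  rw [← this, hf, map_zero]

end MonomialMap

/-! ### The squares ideal as the kernel of a monomial map -/

section Squares

variable {V : Type*} (K : Type*) [Field K]

open Classical in
/-- The total degree and the parities of the exponents of the monomial `x_i`. -/
def parityExponent (i : V) : ℕ × (V → ZMod 2) := (1, Pi.single i 1)

lemma sum_smul_parityExponent [Fintype V] (a : V →₀ ℕ) :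
    (a.sum fun i k => k • parityExponent i) = (a.degree, fun i => (a i : ZMod 2)) := by
  classical
  refine Prod.ext ?_ ?_
  · simp [Finsupp.sum, parityExponent, Finsupp.degree_apply, Prod.fst_sum]
  · ext j
    rw [Finsupp.sum_fintype _ _ (by simp)]
    simp [parityExponent, Prod.snd_sum, Finset.sum_apply, Pi.single_apply]

/-- All squares of variables agree in the quotient, so the even part of each exponent can be moved
to one fixed variable. -/
lemma mk_monomial_eq [Fintype V] (v : V) (a : V →₀ ℕ) :
    Ideal.Quotient.mk (squaresIdeal V K) (monomial a 1) =
      (∏ i, Ideal.Quotient.mk (squaresIdeal V K) (X i) ^ (a i % 2)) *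
        Ideal.Quotient.mk (squaresIdeal V K) (X v) ^ (2 * ∑ i, a i / 2) := by
  have hsq : ∀ i, Ideal.Quotient.mk (squaresIdeal V K) (X i) ^ 2 =
      Ideal.Quotient.mk (squaresIdeal V K) (X v) ^ 2 := by
    intro i
    rw [← map_pow, ← map_pow, Ideal.Quotient.eq]
    exact Ideal.subset_span ⟨i, v, rfl⟩
  rw [monomial_eq, Finsupp.prod_fintype _ _ (by simp), pow_mul, ← Finset.prod_pow_eq_pow_sum,
    ← Finset.prod_mul_distrib]
  simp only [map_one, one_mul, map_prod, map_pow]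
  refine Finset.prod_congr rfl fun i _ => ?_
  conv_lhs => rw [← Nat.mod_add_div (a i) 2, pow_add, pow_mul, hsq i]

lemma mk_monomial_congr [Fintype V] [Nonempty V] {a b : V →₀ ℕ}
    (h : (a.sum fun i k => k • parityExponent i) = b.sum fun i k => k • parityExponent i) :
    Ideal.Quotient.mk (squaresIdeal V K) (monomial a 1) =
      Ideal.Quotient.mk (squaresIdeal V K) (monomial b 1) := by
  obtain ⟨v⟩ := ‹Nonempty V›
  rw [sum_smul_parityExponent, sum_smul_parityExponent, Prod.mk.injEq] at h
  obtain ⟨hdeg, hpar⟩ := h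
  have hmod : ∀ i, a i % 2 = b i % 2 := fun i =>
    (ZMod.natCast_eq_natCast_iff' _ _ _).mp (congrFun hpar i)
  rw [mk_monomial_eq K v a, mk_monomial_eq K v b]
  have hsum : ∀ c : V →₀ ℕ, c.degree = ∑ i, c i % 2 + 2 * ∑ i, c i / 2 := by
    intro c
    rw [Finsupp.degree_eq_sum, Finset.mul_sum, ← Finset.sum_add_distrib]
    exact Finset.sum_congr rfl fun i _ => (Nat.mod_add_div _ _).symm
  have := hsum a
  have := hsum b
  simp only [hmod] at *
  congr 2
  omega

lemma squaresIdeal_eq_ker [Fintype V] [Nonempty V] :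
    squaresIdeal V K = RingHom.ker (monomialMap K (parityExponent (V := V))) := by
  classical
  apply le_antisymm
  · rw [squaresIdeal, Ideal.span_le]
    rintro _ ⟨i, j, rfl⟩
    have h2 : (1 : ZMod 2) + 1 = 0 := by decide
    have : ∀ i : V, 2 • parityExponent i = (2, 0) := by
      intro i
      rw [two_nsmul, parityExponent, Prod.mk_add_mk, ← Pi.single_add, h2, Pi.single_zero]
    simp [RingHom.mem_ker, monomialMap, AddMonoidAlgebra.single_pow, this]
  · intro f hf
    let ε : (V →₀ ℕ) → ℕ × (V → ZMod 2) := fun a => a.sum fun i k => k • parityExponent i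
    let r := Function.invFun ε
    -- The quotient map factors through the monomial map, via a chosen monomial for each exponent,
    -- so it kills the kernel.
    have key : linearExtend (fun p => Ideal.Quotient.mkₐ K (squaresIdeal V K) (monomial (r p) 1)) ∘ₗ
        (monomialMap K parityExponent).toLinearMap =
          (Ideal.Quotient.mkₐ K (squaresIdeal V K)).toLinearMap := by
      refine MvPolynomial.linearMap_ext fun a => LinearMap.ext_ring ?_
      simp only [LinearMap.comp_apply, AlgHom.toLinearMap_apply, monomialMap_monomial,
        linearExtend_single, one_smul]
      exact mk_monomial_congr K (Function.invFun_eq (f := ε) ⟨a, rfl⟩)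
    have := LinearMap.congr_fun key f
    rw [RingHom.mem_ker] at hf
    simp only [LinearMap.comp_apply, AlgHom.toLinearMap_apply, hf, map_zero] at this
    exact Ideal.Quotient.eq_zero_iff_mem.mp this.symm

end Squares

/-! ### Sums of exactly `n` vectors over `F₂` -/

section ExponentSet

variable {σ M : Type*} [AddCommMonoid M]

lemma zero_mem_exponentSet (g : σ → M) : 0 ∈ exponentSet g 0 :=
  ⟨0, by simp, by simp⟩

lemma mem_exponentSet_one (g : σ → M) (i : σ) : g i ∈ exponentSet g 1 :=
  ⟨Finsupp.single i 1, by simp, by simp⟩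

lemma add_mem_exponentSet {g : σ → M} {p q : M} {m n : ℕ} (hp : p ∈ exponentSet g m)
    (hq : q ∈ exponentSet g n) : p + q ∈ exponentSet g (m + n) := by
  classical
  obtain ⟨a, rfl, rfl⟩ := hp
  obtain ⟨b, rfl, rfl⟩ := hq
  exact ⟨a + b, by simp, Finsupp.sum_add_index' (by simp) fun i k l => add_smul k l (g i)⟩

lemma ncard_exponentSet_le_succ {A : Type*} [AddCommGroup A] [Nonempty σ] [Finite A]
    (g : σ → A) (n : ℕ) :
    (exponentSet g n).ncard ≤ (exponentSet g (n + 1)).ncard := by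
  obtain ⟨i⟩ := ‹Nonempty σ›
  exact Set.ncard_le_ncard_of_injOn (· + g i)
    (fun p hp => add_mem_exponentSet hp (mem_exponentSet_one g i))
    (add_left_injective (g i)).injOn (Set.toFinite _)

variable {A : Type*} [AddCommGroup A] [Module (ZMod 2) A] {g : σ → A}

lemma exponentSet_subset_span (n : ℕ) :
    exponentSet g n ⊆ Submodule.span (ZMod 2) (Set.range g) := by
  rintro _ ⟨a, _, rfl⟩
  exact Submodule.sum_mem _ fun i _ => nsmul_mem (Submodule.subset_span (Set.mem_range_self i)) _

lemma exists_mem_exponentSet_of_mem_span {p : A}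
    (hp : p ∈ Submodule.span (ZMod 2) (Set.range g)) : ∃ n, p ∈ exponentSet g n := by
  induction hp using Submodule.span_induction with
  | mem x hx =>
    obtain ⟨i, rfl⟩ := hx
    exact ⟨1, mem_exponentSet_one g i⟩
  | zero => exact ⟨0, zero_mem_exponentSet g⟩
  | add x y _ _ hx hy =>
    obtain ⟨m, hm⟩ := hx
    obtain ⟨n, hn⟩ := hy
    exact ⟨m + n, add_mem_exponentSet hm hn⟩
  | smul c x _ hx =>
    have hc : c = 0 ∨ c = 1 := by revert c; decide
    rcases hc with rfl | rfl
    · exact ⟨0, by simpa using zero_mem_exponentSet g⟩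
    · simpa using hx

lemma zero_mem_exponentSet_two_mul [Nonempty σ] (k : ℕ) : (0 : A) ∈ exponentSet g (2 * k) := by
  induction k with
  | zero => exact zero_mem_exponentSet g
  | succ k ih =>
    obtain ⟨i⟩ := ‹Nonempty σ›
    have h2 : g i + g i = 0 := by
      rw [← two_smul (ZMod 2), show (2 : ZMod 2) = 0 by decide, zero_smul]
    have := add_mem_exponentSet ih
      (add_mem_exponentSet (mem_exponentSet_one g i) (mem_exponentSet_one g i))
    simpa [h2, mul_add] using this

lemma exponentSet_mono [Nonempty σ] {p : A} {m n : ℕ} (hp : p ∈ exponentSet g m) (hmn : m ≤ n)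
    (hpar : Even (n - m)) : p ∈ exponentSet g n := by
  obtain ⟨k, hk⟩ := hpar
  have := add_mem_exponentSet hp (zero_mem_exponentSet_two_mul (g := g) k)
  rwa [add_zero, show m + 2 * k = n by omega] at this

lemma exists_forall_mem_exponentSet_or [Nonempty σ] [Finite A] :
    ∃ N, ∀ n, N ≤ n → ∀ p ∈ Submodule.span (ZMod 2) (Set.range g),
      p ∈ exponentSet g n ∨ p ∈ exponentSet g (n + 1) := by
  have h : ∀ p : A, ∃ N, p ∈ Submodule.span (ZMod 2) (Set.range g) → p ∈ exponentSet g N := by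
    intro p
    by_cases hp : p ∈ Submodule.span (ZMod 2) (Set.range g)
    · obtain ⟨N, hN⟩ := exists_mem_exponentSet_of_mem_span hp
      exact ⟨N, fun _ => hN⟩
    · exact ⟨0, fun h => absurd h hp⟩
  choose ν hν using h
  obtain ⟨N, hN⟩ := (Set.finite_range ν).bddAbove
  refine ⟨N, fun n hn p hp => ?_⟩
  have hle : ν p ≤ n := (hN ⟨p, rfl⟩).trans hn
  rcases Nat.even_or_odd (n - ν p) with he | ho
  · exact Or.inl (exponentSet_mono (hν p hp) hle he)
  · refine Or.inr (exponentSet_mono (hν p hp) (by omega) ?_)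
    rw [Nat.sub_add_comm hle]
    exact ho.add_one

lemma exists_forall_exponentSet_eq_span [Nonempty σ] [Finite A] {k : ℕ} (hk : Odd k)
    (h0 : (0 : A) ∈ exponentSet g k) :
    ∃ N, ∀ n, N ≤ n → exponentSet g n = Submodule.span (ZMod 2) (Set.range g) := by
  obtain ⟨N, hN⟩ := exists_forall_mem_exponentSet_or (g := g)
  refine ⟨N + k, fun n hn => (exponentSet_subset_span n).antisymm fun p hp => ?_⟩
  obtain ⟨l, rfl⟩ := hk
  rcases hN (n - (2 * l + 1)) (by omega) p hp with h | h
  · have := add_mem_exponentSet h h0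
    rwa [add_zero, Nat.sub_add_cancel (by omega)] at this
  · exact exponentSet_mono h (by omega) ⟨l, by omega⟩

lemma map_of_mem_exponentSet {f : A →ₗ[ZMod 2] ZMod 2} (hf : ∀ i, f (g i) = 1) {p : A} {n : ℕ}
    (hp : p ∈ exponentSet g n) : f p = n := by
  obtain ⟨a, rfl, rfl⟩ := hp
  simp [Finsupp.sum, map_sum, hf, Finsupp.degree_apply]

/-- The functional reads off `n` mod 2, so consecutive sets are disjoint and, for large `n`, fill
the span. Their sizes are nondecreasing in `n` with constant consecutive sums, hence equal. -/
lemma exists_forall_two_mul_ncard_exponentSet [Nonempty σ] [Finite A] {f : A →ₗ[ZMod 2] ZMod 2}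
    (hf : ∀ i, f (g i) = 1) :
    ∃ N, ∀ n, N ≤ n →
      2 * (exponentSet g n).ncard = Nat.card (Submodule.span (ZMod 2) (Set.range g)) := by
  obtain ⟨N, hN⟩ := exists_forall_mem_exponentSet_or (g := g)
  have key : ∀ n, N ≤ n → (exponentSet g n).ncard + (exponentSet g (n + 1)).ncard =
      Nat.card (Submodule.span (ZMod 2) (Set.range g)) := by
    intro n hn
    rw [← Set.ncard_union_eq ?_ (Set.toFinite _) (Set.toFinite _)]
    · have : exponentSet g n ∪ exponentSet g (n + 1) =
          Submodule.span (ZMod 2) (Set.range g) :=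
        (Set.union_subset (exponentSet_subset_span _) (exponentSet_subset_span _)).antisymm
          fun p hp => hN n hn p hp
      rw [this]
      rfl
    · refine Set.disjoint_left.mpr fun p hp hp' => ?_
      have := (map_of_mem_exponentSet hf hp).symm.trans (map_of_mem_exponentSet hf hp')
      simp at this
  refine ⟨N, fun n hn => ?_⟩
  have h1 := key n hn
  have h2 := key (n + 1) (by omega)
  have h3 := ncard_exponentSet_le_succ g n
  have h4 := ncard_exponentSet_le_succ g (n + 1)
  omega

/-- Duality: `(1, 0)` in the span of the `(1, g i)` is an odd relation; otherwise some functional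
kills this span but not `(1, 0)`, and its restriction to `A` is 1 on each `g i`. -/
lemma exists_linear_or_exists_odd_zero_mem (g : σ → A) :
    (∃ f : A →ₗ[ZMod 2] ZMod 2, ∀ i, f (g i) = 1) ∨
      ∃ k, Odd k ∧ (0 : A) ∈ exponentSet g k := by
  by_cases h : ((1 : ZMod 2), (0 : A)) ∈
      Submodule.span (ZMod 2) (Set.range fun i => ((1 : ZMod 2), g i))
  · right
    obtain ⟨n, a, ha, hsum⟩ := exists_mem_exponentSet_of_mem_span h
    obtain ⟨h1, h2⟩ := Prod.ext_iff.mp hsum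
    simp only [Finsupp.sum, Prod.fst_sum, Prod.snd_sum, Prod.smul_fst, Prod.smul_snd] at h1 h2
    refine ⟨n, ?_, a, ha, h2⟩
    rw [← ZMod.natCast_eq_one_iff_odd, ← h1, ← ha]
    simp [Finsupp.degree_apply]
  · left
    obtain ⟨F, hF, hker⟩ := Submodule.exists_le_ker_of_notMem h
    have hF1 : F (1, 0) = 1 := by
      revert hF
      generalize F (1, 0) = x
      revert x
      decide
    refine ⟨F ∘ₗ LinearMap.inr _ _ _, fun i => ?_⟩
    have h0 : F (1, g i) = 0 := hker (Submodule.subset_span ⟨i, rfl⟩)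
    have hadd : F (1, g i) = F (1, 0) + F (0, g i) := by rw [← map_add]; simp
    rw [hadd, hF1] at h0
    simp only [LinearMap.comp_apply, LinearMap.inr_apply]
    revert h0
    generalize F (0, g i) = x
    revert x
    decide

end ExponentSet

/-! ### Edge vectors, 2-colourings and connected components -/

section Graph

variable {V : Type*} (G : SimpleGraph V)

open Classical in
/-- The incidence vector modulo two of an edge. -/
def edgeVector (e : Sym2 V) : V → ZMod 2 :=
  Sym2.lift ⟨fun i j => Pi.single i 1 + Pi.single j 1, fun _ _ => add_comm _ _⟩ e

open Classical in
lemma edgeVector_mk (i j : V) :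
    edgeVector s(i, j) = Pi.single i (1 : ZMod 2) + Pi.single j 1 := rfl

lemma idealXG_eq_ker (K : Type*) [Field K] [Fintype V] [Nonempty V] :
    idealXG K G =
      RingHom.ker (monomialMap K fun e : G.edgeSet => ((2 : ℕ), edgeVector (e : Sym2 V))) := by
  classical
  have hcomp : (monomialMap K (parityExponent (V := V))).comp (theta K G) =
      monomialMap K fun e : G.edgeSet => ((2 : ℕ), edgeVector (e : Sym2 V)) := by
    refine MvPolynomial.algHom_ext fun ⟨e, he⟩ => ?_
    induction e using Sym2.ind with
    | _ i j =>
      simp [theta, monomialMap, parityExponent, edgeVector_mk, AddMonoidAlgebra.single_mul_single]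
  rw [idealXG, squaresIdeal_eq_ker, ← hcomp]
  rfl

lemma exponentSet_edge (n : ℕ) :
    exponentSet (fun e : G.edgeSet => ((2 : ℕ), edgeVector (e : Sym2 V))) n =
      (fun s => (2 * n, s)) '' exponentSet (fun e : G.edgeSet => edgeVector (e : Sym2 V)) n := by
  rw [exponentSet, exponentSet, Set.image_image]
  refine Set.image_congr fun a ha => ?_
  refine Prod.ext ?_ ?_
  · rw [← show a.degree = n from ha]
    simp [Finsupp.sum, Prod.fst_sum, Finsupp.degree_apply, Finset.mul_sum, mul_comm]
  · simp [Finsupp.sum, Prod.snd_sum]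

lemma hilbertFunction_idealXG (K : Type*) [Field K] [Fintype V] [Nonempty V] (n : ℕ) :
    hilbertFunction (idealXG K G) n =
      (exponentSet (fun e : G.edgeSet => edgeVector (e : Sym2 V)) n).ncard := by
  rw [idealXG_eq_ker, hilbertFunction_ker_monomialMap, exponentSet_edge,
    Set.ncard_image_of_injective _ (Prod.mk_right_injective _)]

lemma homogeneousComponent_mem_idealXG (K : Type*) [Field K] [Fintype V] [Nonempty V]
    {f : MvPolynomial G.edgeSet K} (hf : f ∈ idealXG K G) (n : ℕ) :
    homogeneousComponent n f ∈ idealXG K G := by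
  rw [idealXG_eq_ker] at hf ⊢
  exact homogeneousComponent_mem_ker_monomialMap _ (AddMonoidHom.fst _ _) two_ne_zero
    (fun _ => rfl) hf n

lemma hasDegree_idealXG (K : Type*) [Field K] [Fintype V] [Nonempty V] {c : ℕ} (hc : c ≠ 0)
    (h : ∃ N, ∀ n, N ≤ n →
      (exponentSet (fun e : G.edgeSet => edgeVector (e : Sym2 V)) n).ncard = c) :
    HasDegree (idealXG K G) c := by
  obtain ⟨N, hN⟩ := h
  refine ⟨fun f hf n => homogeneousComponent_mem_idealXG G K hf n, Polynomial.C (c : ℚ),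
    ⟨N, fun n hn => ?_⟩, fun _ => ?_, fun h0 => ?_⟩
  · rw [hilbertFunction_idealXG, hN n hn, Polynomial.eval_C]
  · rw [Polynomial.natDegree_C, Polynomial.leadingCoeff_C, Nat.factorial_zero, Nat.cast_one,
      one_mul]
  · exact absurd h0 (by simpa using hc)

/-- A functional is its values on the basis vectors; two elements of `F₂` sum to 1 exactly when they
differ. -/
lemma isBipartite_iff_exists_linear [Fintype V] :
    G.IsBipartite ↔ ∃ f : (V → ZMod 2) →ₗ[ZMod 2] ZMod 2,
      ∀ e : G.edgeSet, f (edgeVector (e : Sym2 V)) = 1 := by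
  classical
  constructor
  · rintro ⟨c⟩
    let d : V → ZMod 2 := c
    refine ⟨Fintype.linearCombination (ZMod 2) d, ?_⟩
    rintro ⟨e, he⟩
    induction e using Sym2.ind with
    | _ i j =>
      have hne : d i ≠ d j := c.valid he
      rw [edgeVector_mk, map_add, Fintype.linearCombination_apply_single,
        Fintype.linearCombination_apply_single, one_smul, one_smul]
      revert hne
      generalize d i = x, d j = y
      revert x y
      decide
  · rintro ⟨f, hf⟩
    refine ⟨SimpleGraph.Coloring.mk (fun v => (f (Pi.single v 1) : ZMod 2)) fun {i j} hij heq => ?_⟩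
    have := hf ⟨s(i, j), hij⟩
    have heq' : f (Pi.single i 1) = f (Pi.single j 1) := heq
    rw [edgeVector_mk, map_add, heq'] at this
    revert this
    generalize f (Pi.single j 1) = x
    revert x
    decide

/-- The sums of a vector over the connected components. -/
def componentSum [Fintype V] : (V → ZMod 2) →ₗ[ZMod 2] (G.ConnectedComponent → ZMod 2) :=
  open Classical in
  Fintype.linearCombination (ZMod 2) fun v => Pi.single (G.connectedComponentMk v) 1

open Classical in
lemma componentSum_single [Fintype V] (v : V) (c : ZMod 2) :
    componentSum G (Pi.single v c) = Pi.single (G.connectedComponentMk v) c := by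
  rw [componentSum, Fintype.linearCombination_apply_single, ← Pi.single_smul, smul_eq_mul, mul_one]

open Classical in
-- The edge vectors along a walk telescope mod 2.
lemma single_add_single_mem_span {u v : V} (h : G.Reachable u v) :
    Pi.single u (1 : ZMod 2) + Pi.single v 1 ∈
      Submodule.span (ZMod 2) (Set.range fun e : G.edgeSet => edgeVector (e : Sym2 V)) := by
  obtain ⟨p⟩ := h
  have h2 : (1 : ZMod 2) + 1 = 0 := by decide
  induction p with
  | nil => rw [← Pi.single_add, h2, Pi.single_zero]; exact zero_mem _
  | @cons a b c hab p ih =>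
    have hmem := add_mem (Submodule.subset_span (R := ZMod 2)
      (Set.mem_range_self (f := fun e : G.edgeSet => edgeVector (e : Sym2 V)) ⟨s(a, b), hab⟩)) ih
    have : edgeVector s(a, b) + (Pi.single b (1 : ZMod 2) + Pi.single c 1) =
        Pi.single a 1 + Pi.single c 1 := by
      rw [edgeVector_mk, add_add_add_comm, add_comm (Pi.single b _) (Pi.single c _),
        add_add_add_comm, ← add_assoc, add_assoc, ← Pi.single_add, h2]
      simp
    rwa [← this]

lemma ker_componentSum [Fintype V] :
    LinearMap.ker (componentSum G) =
      Submodule.span (ZMod 2) (Set.range fun e : G.edgeSet => edgeVector (e : Sym2 V)) := by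
  classical
  have h2 : (1 : ZMod 2) + 1 = 0 := by decide
  apply le_antisymm
  · intro x hx
    set W := Submodule.span (ZMod 2) (Set.range fun e : G.edgeSet => edgeVector (e : Sym2 V))
    -- Modulo `W` each vertex equals the representative of its component, so the quotient map
    -- factors through `componentSum`.
    let r : (G.ConnectedComponent → ZMod 2) →ₗ[ZMod 2] (V → ZMod 2) ⧸ W :=
      Fintype.linearCombination (ZMod 2) fun c => W.mkQ (Pi.single c.out 1)
    have key : r ∘ₗ componentSum G = W.mkQ := by
      refine LinearMap.pi_ext' fun v => LinearMap.ext_ring ?_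
      simp only [LinearMap.comp_apply, LinearMap.single_apply, componentSum_single, r,
        Fintype.linearCombination_apply_single, one_smul]
      rw [← sub_eq_zero, ← map_sub, Submodule.mkQ_apply, Submodule.Quotient.mk_eq_zero,
        sub_eq_add_neg, ← Pi.single_neg, show (-1 : ZMod 2) = 1 by decide]
      exact single_add_single_mem_span G
        (SimpleGraph.ConnectedComponent.exact (Quot.out_eq (G.connectedComponentMk v)))
    have := LinearMap.congr_fun key x
    rw [LinearMap.comp_apply, LinearMap.mem_ker.mp hx, map_zero] at this
    exact (Submodule.Quotient.mk_eq_zero W).mp this.symm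
  · rw [Submodule.span_le]
    rintro _ ⟨⟨e, he⟩, rfl⟩
    induction e using Sym2.ind with
    | _ i j =>
      have : G.connectedComponentMk i = G.connectedComponentMk j :=
        SimpleGraph.ConnectedComponent.sound (SimpleGraph.Adj.reachable he)
      simp only [SetLike.mem_coe, LinearMap.mem_ker, edgeVector_mk, map_add, componentSum_single]
      rw [this, ← Pi.single_add, h2, Pi.single_zero]

lemma componentSum_surjective [Fintype V] : Function.Surjective (componentSum G) := by
  classical
  rw [← LinearMap.range_eq_top, eq_top_iff, ← (Pi.basisFun (ZMod 2) G.ConnectedComponent).span_eq,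
    Submodule.span_le]
  rintro _ ⟨c, rfl⟩
  induction c using SimpleGraph.ConnectedComponent.ind with
  | _ v => exact ⟨Pi.single v 1, by rw [componentSum_single, Pi.basisFun_apply]⟩

lemma card_span_edgeVector [Fintype V] :
    Nat.card (Submodule.span (ZMod 2) (Set.range fun e : G.edgeSet => edgeVector (e : Sym2 V))) =
      2 ^ (Fintype.card V - Nat.card G.ConnectedComponent) := by
  classical
  have := Fintype.ofFinite G.ConnectedComponent
  rw [← ker_componentSum, Module.natCard_eq_pow_finrank (K := ZMod 2), Nat.card_zmod]
  congr 1
  have h := LinearMap.finrank_range_add_finrank_ker (componentSum G)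
  rw [LinearMap.range_eq_top.mpr (componentSum_surjective G), finrank_top,
    Module.finrank_fintype_fun_eq_card, Module.finrank_fintype_fun_eq_card] at h
  rw [Nat.card_eq_fintype_card]
  omega

end Graph

end

end GraphIdeal

theorem mainTheorem6 {V : Type*} [Fintype V] [Nonempty V] (K : Type*) [Field K]
    (G : SimpleGraph V) (hG : ∀ v : V, ∃ w : V, G.Adj v w) :
    (¬ G.IsBipartite →
      GraphIdeal.HasDegree (GraphIdeal.idealXG K G)
        (2 ^ (Fintype.card V - Nat.card G.ConnectedComponent))) ∧
    (G.IsBipartite →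
      GraphIdeal.HasDegree (GraphIdeal.idealXG K G)
        (2 ^ (Fintype.card V - Nat.card G.ConnectedComponent - 1))) := by
  have : Nonempty G.edgeSet := by
    obtain ⟨v⟩ := ‹Nonempty V›
    obtain ⟨w, hw⟩ := hG v
    exact ⟨⟨s(v, w), hw⟩⟩
  have hcard := GraphIdeal.card_span_edgeVector G
  rw [GraphIdeal.isBipartite_iff_exists_linear]
  refine ⟨fun hnb => ?_, fun ⟨f, hf⟩ => ?_⟩
  · refine GraphIdeal.hasDegree_idealXG G K (by positivity) ?_
    obtain ⟨k, hk, h0⟩ := (GraphIdeal.exists_linear_or_exists_odd_zero_mem _).resolve_left hnb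
    obtain ⟨N, hN⟩ := GraphIdeal.exists_forall_exponentSet_eq_span hk h0
    exact ⟨N, fun n hn => by rw [hN n hn, ← hcard]; rfl⟩
  · refine GraphIdeal.hasDegree_idealXG G K (by positivity) ?_
    obtain ⟨N, hN⟩ := GraphIdeal.exists_forall_two_mul_ncard_exponentSet hf
    refine ⟨N, fun n hn => ?_⟩
    have h := (hN n hn).trans hcard
    -- An exponent of 0 would make 1 even, so the truncated `- 1` is a true subtraction.
    cases hd : Fintype.card V - Nat.card G.ConnectedComponent with
    | zero => rw [hd] at h; omega
    | succ d => rw [hd, pow_succ] at h; rw [Nat.add_sub_cancel]; omega
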